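/- Let $d\ge 2$ and $n\ge 0$ be integers and let $\varepsilon\in[0,1]$. Let $\mathbb{P}=\mathcal{B}(\varepsilon)^{\otimes\mathbb{Z}^d}$ be the law of a random configuration $b\in\{0,1\}^{\mathbb{Z}^d}$ with independent coordinates, each equal to $1$ (closed) with probability $\varepsilon$ and to $0$ (open) with probability $1-\varepsilon$. The $n$-thickened configuration $\gamma_n(b)\in\{0,1\}^{\mathbb{Z}^d}$ is defined by $\gamma_n(b)_c=\max_{k\in\{-n,\dots,n\}^d} b_{c+k}$ for $c\in\mathbb{Z}^d$. The components of $\gamma_n(b)$ are the connected components of the subgraph induced by its open cells $\{c:\gamma_n(b)_c=0\}$ in the nearest-neighbour graph of $\mathbb{Z}^d$ (two cells are adjacent when they differ by $1$ in exactly one coordinate). Let $I(b)\subset\mathbb{Z}^d$ be the infinite component of $\gamma_n(b)$, that is, the set of cells whose component in $\gamma_n(b)$ is infinite (the infinite component when there is exactly one, and the empty set when there is none). Then $$\mathbb{P}(0\notin I)\le 48\,(2n+1)^d\,\varepsilon .$$ -/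

import Mathlib

open MeasureTheory ProbabilityTheory

namespace ThickPercolation

/-- The cells of the grid `ℤ^d`. -/
abbrev Cell (d : ℕ) : Type := Fin d → ℤ

/-- Configurations in `{0,1}^{ℤ^d}`; the value `0` means open (clear) and `1` means
closed (obscured). -/
abbrev Config (d : ℕ) : Type := Cell d → Fin 2

/-- The box `B_n = ⟦-n, n⟧^d`. -/
noncomputable def box (d n : ℕ) : Finset (Cell d) :=
  Fintype.piFinset fun _ => Finset.Icc (-(n : ℤ)) (n : ℤ)

/-- The cellular automaton `γ_n`: the value at `c` is the maximum of `b` over `c + B_n`. -/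
noncomputable def thicken {d : ℕ} (n : ℕ) (b : Config d) : Config d :=
  fun c => (box d n).sup fun k => b (c + k)

/-- The nearest-neighbour graph on `ℤ^d`: two cells are adjacent when they differ in exactly
one coordinate, by exactly `1`, that is, when their `ℓ¹`-distance is `1`. -/
def gridGraph (d : ℕ) : SimpleGraph (Cell d) where
  Adj x y := ∑ i, |x i - y i| = 1
  symm := ⟨fun x y h => by simpa only [abs_sub_comm] using h⟩
  loopless := ⟨fun x h => by simp at h⟩

/-- The open cells of a configuration. -/
def openCells {d : ℕ} (w : Config d) : Set (Cell d) := {c | w c = 0}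

/-- The graph of the site percolation `w`: the grid graph restricted to the open cells. -/
def openGraph {d : ℕ} (w : Config d) : SimpleGraph (openCells w) :=
  (gridGraph d).induce (openCells w)

/-- `C` is an infinite (open) connected component of the site percolation `w`. -/
def IsInfiniteComponent {d : ℕ} (w : Config d) (C : Set (Cell d)) : Prop :=
  C.Infinite ∧ ∃ K : (openGraph w).ConnectedComponent, C = Subtype.val '' K.supp

/-- The cells that belong to an infinite component of `w`. When `w` has exactly one infinite
component, this set is that component; when it has none, this set is empty. -/
def infiniteComponent {d : ℕ} (w : Config d) : Set (Cell d) :=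
  ⋃₀ {C | IsInfiniteComponent w C}

/-- The `ε`-Bernoulli site percolation `B(ε)^{⊗ ℤ^d}`: the cells are independent, and each is
closed (value `1`) with probability `ε` and open (value `0`) with probability `1 - ε`. -/
noncomputable def bernoulliPercolation (d : ℕ) (ε : unitInterval) : Measure (Config d) :=
  Measure.infinitePi fun _ : Cell d => bernoulliMeasure (1 : Fin 2) 0 ε

end ThickPercolation

/-! This is a Peierls argument in the plane of the first two coordinates. If the origin is open
after thickening but lies in no infinite component, its cluster in that plane is finite. By
`exists_boundary_path`, the boundary of the cluster then contains a diagonal-connected path from the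
positive to the negative first axis. Each boundary cell has a closed cell of `b` within distance
`n`; these cells form a chain with at most `9 * V` choices per step, where `V = (2 * n + 1) ^ d`.

A chain starting in the `m`-th axis box must cross to the other side of the origin, so it contains a
self-avoiding chain of `m` steps. Summing `V * (9 * V) ^ m * ε ^ (m + 1)` over `m` gives `V * ε / (1
- 9 * V * ε)`. -/

namespace ThickPercolation

/-! ### Plane topology: the boundary of a finite connected set -/

/-- Two points of the plane grid are neighbours. -/
def PlaneAdj (p q : ℤ × ℤ) : Prop := |p.1 - q.1| + |p.2 - q.2| = 1

/-- The points outside `C` that have a neighbour in `C`. -/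
def outerBoundary (C : Set (ℤ × ℤ)) : Set (ℤ × ℤ) := {q | q ∉ C ∧ ∃ p ∈ C, PlaneAdj p q}

/-- Adjacency, diagonals included, between two points of the outer boundary of `C`. -/
def BoundaryStep (C : Set (ℤ × ℤ)) (p q : ℤ × ℤ) : Prop :=
  p ∈ outerBoundary C ∧ q ∈ outerBoundary C ∧ |p.1 - q.1| ≤ 1 ∧ |p.2 - q.2| ≤ 1

theorem exists_int_antiderivative (a : ℤ → ℤ) :
    ∃ F : ℤ → ℤ, F 0 = 0 ∧ ∀ x, F (x + 1) - F x = a x := by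
  refine ⟨fun x => ∑ i ∈ Finset.Ico 0 x, a i - ∑ i ∈ Finset.Ico x 0, a i, by simp, fun x => ?_⟩
  rcases le_or_gt 0 x with hx | hx
  · have h : Finset.Ico 0 (x + 1) = insert x (Finset.Ico 0 x) := by
      ext y; simp only [Finset.mem_Ico, Finset.mem_insert]; omega
    have h1 : Finset.Ico x 0 = ∅ := Finset.Ico_eq_empty (by omega)
    have h2 : Finset.Ico (x + 1) 0 = ∅ := Finset.Ico_eq_empty (by omega)
    simp [h, h1, h2]
  · have h : Finset.Ico x 0 = insert x (Finset.Ico (x + 1) 0) := by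
      ext y; simp only [Finset.mem_Ico, Finset.mem_insert]; omega
    have h1 : Finset.Ico 0 x = ∅ := Finset.Ico_eq_empty (by omega)
    have h2 : Finset.Ico 0 (x + 1) = ∅ := Finset.Ico_eq_empty (by omega)
    have h3 : x ∉ Finset.Ico (x + 1) 0 := by simp
    simp only [h, h1, h2, Finset.sum_insert h3, Finset.sum_empty]; ring

/-- Discrete Poincaré lemma on `ℤ²`. -/
theorem exists_potential (h v : ℤ → ℤ → ℤ)
    (closed : ∀ x y, h x y + v (x + 1) y = v x y + h x (y + 1)) :
    ∃ f : ℤ → ℤ → ℤ, (∀ x y, f (x + 1) y - f x y = h x y) ∧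
      ∀ x y, f x (y + 1) - f x y = v x y := by
  obtain ⟨H, -, hH⟩ := exists_int_antiderivative fun x => h x 0
  choose V hV0 hV using fun x => exists_int_antiderivative (v x)
  refine ⟨fun x y => H x + V x y, fun x y => ?_, fun x y => ?_⟩
  · induction y with
    | zero => have := hH x; simp [hV0]; linarith
    | succ i ih =>
      have := closed x i; have := hV x i; have := hV (x + 1) i; linarith
    | pred i ih =>
      have h1 := closed x (-i - 1); have h2 := hV x (-i - 1); have h3 := hV (x + 1) (-i - 1)
      simp only [sub_add_cancel] at h1 h2 h3
      linarith
  · have := hV x y; linarith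

theorem eq_of_int_step_eq {g : ℤ → ℤ} {k m : ℤ} (hkm : k ≤ m)
    (h : ∀ x, k ≤ x → x < m → g (x + 1) = g x) : g m = g k := by
  induction m, hkm using Int.leInduction with
  | base => rfl
  | succ m hm ih =>
    rw [h m hm (by omega)]
    exact ih fun x hx hxm => h x hx (by omega)

theorem exists_last_exit {P : ℤ → Prop} (h0 : P 0) {R : ℤ} (hR : ∀ x, P x → x < R) :
    ∃ k, 1 ≤ k ∧ k ≤ R ∧ P (k - 1) ∧ ∀ x, k ≤ x → ¬ P x := by
  obtain ⟨m, hm, hmax⟩ := Int.exists_greatest_of_bdd (P := P) ⟨R, fun z hz => (hR z hz).le⟩ ⟨0, h0⟩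
  refine ⟨m + 1, by linarith [hmax 0 h0], hR m hm, by simpa using hm, fun x hx hP => ?_⟩
  linarith [hmax x hP]

/-- A cohomological argument: the differential of the indicator of `C`, cut down to one boundary
component, is still closed, hence has a potential. Going around far from `C` shows that its jumps at
the two axis exits agree. -/
theorem exists_boundary_path {C : Set (ℤ × ℤ)} (hfin : C.Finite) (h0 : (0, 0) ∈ C)
    (hconn : ∀ p ∈ C, Relation.ReflTransGen (fun p q => p ∈ C ∧ q ∈ C ∧ PlaneAdj p q) (0, 0) p) :
    ∃ k l : ℤ, 1 ≤ k ∧ 1 ≤ l ∧ (k, 0) ∈ outerBoundary C ∧ (-l, 0) ∈ outerBoundary C ∧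
      Relation.ReflTransGen (BoundaryStep C) (k, 0) (-l, 0) := by
  classical
  obtain ⟨R, hR⟩ : ∃ R : ℤ, ∀ p ∈ C, |p.1| < R ∧ |p.2| < R := by
    obtain ⟨R, hR⟩ := (hfin.image fun p => max |p.1| |p.2|).bddAbove
    refine ⟨R + 1, fun p hp => ?_⟩
    have := hR (Set.mem_image_of_mem _ hp)
    have := max_le_iff.1 this
    omega
  obtain ⟨k, hk1, hkR, hkC, hk⟩ := exists_last_exit (P := fun x => (x, (0 : ℤ)) ∈ C) h0
    (fun x hx => (le_abs_self x).trans_lt (hR _ hx).1)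
  obtain ⟨l, hl1, hlR, hlC, hl⟩ := exists_last_exit (P := fun x => (-x, (0 : ℤ)) ∈ C) (by simpa)
    (fun x hx => (le_abs_self x).trans_lt (by simpa using (hR _ hx).1))
  have hkB : (k, 0) ∈ outerBoundary C := ⟨hk k le_rfl, _, hkC, by simp [PlaneAdj]⟩
  have hlB : (-l, 0) ∈ outerBoundary C := ⟨hl l le_rfl, _, hlC, by simp [PlaneAdj]⟩
  refine ⟨k, l, hk1, hl1, hkB, hlB, ?_⟩
  set T : Set (ℤ × ℤ) := {q | Relation.ReflTransGen (BoundaryStep C) (k, 0) q}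
  have hTB : ∀ q ∈ T, q ∈ outerBoundary C := fun q hq => by
    rcases Relation.ReflTransGen.cases_tail hq with h | ⟨_, _, h⟩
    · exact h ▸ hkB
    · exact h.2.1
  have hTstep : ∀ p ∈ T, ∀ q ∈ outerBoundary C, |p.1 - q.1| ≤ 1 → |p.2 - q.2| ≤ 1 → q ∈ T :=
    fun p hp q hq h1 h2 => Relation.ReflTransGen.tail hp ⟨hTB p hp, hq, h1, h2⟩
  let c : ℤ × ℤ → ℤ := fun p => if p ∈ C then 1 else 0
  -- Only edges touching the boundary component `T` of `(k, 0)` count.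
  let ω : ℤ × ℤ → ℤ × ℤ → ℤ := fun p q => if p ∈ T ∨ q ∈ T then c q - c p else 0
  have hω_eq : ∀ p q r : ℤ × ℤ, r ∈ T → PlaneAdj p q → |r.1 - p.1| ≤ 1 → |r.2 - p.2| ≤ 1 →
      |r.1 - q.1| ≤ 1 → |r.2 - q.2| ≤ 1 → ω p q = c q - c p := by
    intro p q r hr hpq h1 h2 h3 h4
    by_cases hp : p ∈ C <;> by_cases hq : q ∈ C
    · simp [ω, c, hp, hq]
    · have : q ∈ T := hTstep r hr q ⟨hq, p, hp, hpq⟩ h3 h4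
      simp [ω, this]
    · have : p ∈ T := hTstep r hr p ⟨hp, q, hq, by
        simpa [PlaneAdj, abs_sub_comm] using hpq⟩ h1 h2
      simp [ω, this]
    · simp [ω, c, hp, hq]
  have hω_out : ∀ p q, p ∉ C → q ∉ C → ω p q = 0 := by
    intro p q hp hq; simp [ω, c, hp, hq]
  have hω_in : ∀ p q, p ∈ C → q ∈ C → ω p q = 0 := by
    intro p q hp hq; simp [ω, c, hp, hq]
  obtain ⟨f, hfh, hfv⟩ := exists_potential (fun x y => ω (x, y) (x + 1, y))
    (fun x y => ω (x, y) (x, y + 1)) (by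
      intro x y
      -- Boundary points of one unit square are mutually adjacent, diagonals included: if the square
      -- meets `T`, then `ω` is the differential of `c` on it; otherwise `ω` vanishes on it.
      by_cases hsq : ∃ r ∈ T, (r.1 = x ∨ r.1 = x + 1) ∧ (r.2 = y ∨ r.2 = y + 1)
      · obtain ⟨⟨r1, r2⟩, hr, hr1, hr2⟩ := hsq
        have key : ∀ p q : ℤ × ℤ, PlaneAdj p q → (p.1 = x ∨ p.1 = x + 1) → (p.2 = y ∨ p.2 = y + 1) →
            (q.1 = x ∨ q.1 = x + 1) → (q.2 = y ∨ q.2 = y + 1) → ω p q = c q - c p := by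
          intro p q hpq h1 h2 h3 h4
          simp only at hr1 hr2
          apply hω_eq p q _ hr hpq <;> rw [abs_le] <;> constructor <;> simp only <;> omega
        rw [key, key, key, key] <;> simp [PlaneAdj]
      · have hno : ∀ r : ℤ × ℤ, (r.1 = x ∨ r.1 = x + 1) → (r.2 = y ∨ r.2 = y + 1) → r ∉ T :=
          fun r h1 h2 hr => hsq ⟨r, hr, h1, h2⟩
        have a1 := hno (x, y) (by simp) (by simp)
        have a2 := hno (x + 1, y) (by simp) (by simp)
        have a3 := hno (x, y + 1) (by simp) (by simp)
        have a4 := hno (x + 1, y + 1) (by simp) (by simp)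
        simp [ω, a1, a2, a3, a4])
  have hfC : ∀ p ∈ C, f p.1 p.2 = f 0 0 := by
    intro p hp
    induction hconn p hp with
    | refl => rfl
    | @tail p q _ hpq ih =>
      obtain ⟨hpC, hqC, hpq⟩ := hpq
      rw [← ih hpC]
      obtain ⟨p1, p2⟩ := p
      obtain ⟨q1, q2⟩ := q
      simp only [PlaneAdj] at hpq
      have : (q1 = p1 + 1 ∧ q2 = p2) ∨ (p1 = q1 + 1 ∧ q2 = p2) ∨ (q1 = p1 ∧ q2 = p2 + 1) ∨
          (q1 = p1 ∧ p2 = q2 + 1) := by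
        rcases abs_cases (p1 - q1) with h | h <;> rcases abs_cases (p2 - q2) with h' | h' <;> omega
      rcases this with ⟨rfl, rfl⟩ | ⟨rfl, rfl⟩ | ⟨rfl, rfl⟩ | ⟨rfl, rfl⟩
      · have := hfh p1 q2; rw [hω_in _ _ hpC hqC] at this; simp only; omega
      · have := hfh q1 q2; rw [hω_in _ _ hqC hpC] at this; simp only; omega
      · have := hfv q1 p2; rw [hω_in _ _ hpC hqC] at this; simp only; omega
      · have := hfv q1 q2; rw [hω_in _ _ hqC hpC] at this; simp only; omega
  have hfar1 : ∀ x y : ℤ, R ≤ |x| → (x, y) ∉ C := fun x y h hC => absurd (hR _ hC).1 (not_lt.2 h)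
  have hfar2 : ∀ x y : ℤ, R ≤ |y| → (x, y) ∉ C := fun x y h hC => absurd (hR _ hC).2 (not_lt.2 h)
  -- The potential is constant along a route outside `C`: right along the axis, then around the
  -- upper half of the square of radius `R`.
  have e1 : f R 0 = f k 0 := eq_of_int_step_eq (g := fun x => f x 0) hkR fun x hx _ => by
    have := hfh x 0; rw [hω_out _ _ (hk x hx) (hk _ (by omega))] at this; omega
  have e2 : f R R = f R 0 := eq_of_int_step_eq (g := f R) (by omega) fun y _ _ => by
    have := hfv R y
    rw [hω_out _ _ (hfar1 _ _ (le_abs_self R)) (hfar1 _ _ (le_abs_self R))] at this; omega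
  have e3 : f R R = f (-R) R :=
    eq_of_int_step_eq (g := fun x => f x R) (by omega) fun x _ _ => by
      have := hfh x R
      rw [hω_out _ _ (hfar2 _ _ (le_abs_self R)) (hfar2 _ _ (le_abs_self R))] at this; omega
  have e4 : f (-R) R = f (-R) 0 := eq_of_int_step_eq (g := f (-R)) (by omega) fun y _ _ => by
    have hle : R ≤ |(-R)| := by rw [abs_neg]; exact le_abs_self R
    have := hfv (-R) y
    rw [hω_out _ _ (hfar1 _ _ hle) (hfar1 _ _ hle)] at this; omega
  have hl' : ∀ x ≤ -l, (x, (0 : ℤ)) ∉ C := fun x hx => by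
    simpa using hl (-x) (by omega)
  have e5 : f (-l) 0 = f (-R) 0 :=
    eq_of_int_step_eq (g := fun x => f x 0) (by omega) fun x _ hx => by
      have := hfh x 0; rw [hω_out _ _ (hl' x (by omega)) (hl' _ (by omega))] at this; omega
  have hkT : (k, 0) ∈ T := Relation.ReflTransGen.refl
  have e6 : f k 0 - f (k - 1) 0 = -1 := by
    have := hfh (k - 1) 0
    simp only [sub_add_cancel] at this
    rw [this]
    simp [ω, c, hkT, hkC, hkB.1]
  have e7 := hfC _ hkC
  have e8 := hfC _ hlC
  have e9 := hfh (-l) 0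
  simp only at e7 e8
  have hl2 : -(l - 1) = -l + 1 := by ring
  rw [hl2] at e8 hlC
  -- The jump at `-l` must be `1`, but it would be `0` if `T` missed `(-l, 0)`.
  by_contra hlT
  have hlT1 : (-l, 0) ∉ T := hlT
  have hlT2 : (-l + 1, 0) ∉ T := fun h => (hTB _ h).1 hlC
  have : ω (-l, 0) (-l + 1, 0) = 0 := by simp [ω, hlT1, hlT2]
  omega

/-! ### Counting and extracting self-avoiding closed chains -/

theorem bernoulliPercolation_forall_closed (d : ℕ) (ε : unitInterval) (F : Finset (Cell d)) :
    bernoulliPercolation d ε {b | ∀ c ∈ F, b c = 1} = ENNReal.ofReal ε ^ F.card := by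
  have h : {b : Config d | ∀ c ∈ F, b c = 1} = Set.pi F fun _ => {1} := by
    ext b; simp [Set.mem_pi]
  rw [h, bernoulliPercolation, Measure.infinitePi_pi _ (fun _ _ => measurableSet_singleton _),
    Finset.prod_const, bernoulliMeasure_apply_of_mem_of_notMem]
  · congr 1
    rw [ENNReal.ofReal, Real.toNNReal_of_nonneg ε.2.1]
    rfl
  all_goals simp

/-- The lists of length `m` that continue a chain started at `s` whose steps go from `x` to an
element of `nb x`. -/
def chains {α : Type*} [DecidableEq α] (nb : α → Finset α) : ℕ → α → Finset (List α)
  | 0, _ => {[]}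
  | m + 1, s => (nb s).biUnion fun t => (chains nb m t).image (t :: ·)

theorem card_chains_le {α : Type*} [DecidableEq α] {nb : α → Finset α} {K : ℕ}
    (hK : ∀ x, (nb x).card ≤ K) (m : ℕ) (s : α) : (chains nb m s).card ≤ K ^ m := by
  induction m generalizing s with
  | zero => simp [chains]
  | succ m ih =>
    rw [chains, pow_succ']
    refine Finset.card_biUnion_le.trans ?_
    refine (Finset.sum_le_card_nsmul _ _ _ fun t _ => Finset.card_image_le.trans (ih t)).trans ?_
    simpa using Nat.mul_le_mul_right _ (hK s)

theorem mem_chains {α : Type*} [DecidableEq α] {nb : α → Finset α} {l : List α} {s : α}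
    (h : (s :: l).IsChain fun x y => y ∈ nb x) : l ∈ chains nb l.length s := by
  induction l generalizing s with
  | nil => simp [chains]
  | cons t l ih =>
    rw [List.isChain_cons_cons] at h
    simp only [List.length_cons, chains, Finset.mem_biUnion, Finset.mem_image]
    exact ⟨t, h.1, l, ih h.2, rfl⟩

/-- The configurations with a self-avoiding chain of `m` steps from `s` through closed cells. -/
def closedChainEvent {d : ℕ} (nb : Cell d → Finset (Cell d)) (m : ℕ) (s : Cell d) :
    Set (Config d) :=
  {b | ∃ l : List (Cell d), l.length = m ∧ (s :: l).IsChain (fun x y => y ∈ nb x) ∧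
    (s :: l).Nodup ∧ ∀ x ∈ s :: l, b x = 1}

/-- Union bound over chains; self-avoidance makes the `m + 1` cells distinct, hence independent. -/
theorem measure_closedChainEvent_le {d : ℕ} {nb : Cell d → Finset (Cell d)} {K : ℕ}
    (hK : ∀ x, (nb x).card ≤ K) (ε : unitInterval) (m : ℕ) (s : Cell d) :
    bernoulliPercolation d ε (closedChainEvent nb m s) ≤ K ^ m * ENNReal.ofReal ε ^ (m + 1) := by
  classical
  set L := (chains nb m s).filter fun l => l.length = m ∧ (s :: l).Nodup with hL
  have hsub : closedChainEvent nb m s ⊆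
      ⋃ l ∈ L, {b : Config d | ∀ x ∈ (s :: l).toFinset, b x = 1} := by
    rintro b ⟨l, hl, hchain, hnd, hb⟩
    simp only [Set.mem_iUnion]
    refine ⟨l, ?_, fun x hx => hb x (List.mem_toFinset.1 hx)⟩
    exact Finset.mem_filter.2 ⟨hl ▸ mem_chains hchain, hl, hnd⟩
  refine (measure_mono hsub).trans ((measure_biUnion_finset_le _ _).trans ?_)
  have : ∀ l ∈ L, bernoulliPercolation d ε {b : Config d | ∀ x ∈ (s :: l).toFinset, b x = 1}
      ≤ ENNReal.ofReal ε ^ (m + 1) := by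
    intro l hl
    obtain ⟨-, hlen, hnd⟩ := Finset.mem_filter.1 hl
    rw [bernoulliPercolation_forall_closed, List.toFinset_card_of_nodup hnd, List.length_cons, hlen]
  refine (Finset.sum_le_card_nsmul _ _ _ this).trans ?_
  rw [nsmul_eq_mul]
  gcongr
  exact_mod_cast (Finset.card_filter_le _ _).trans (card_chains_le hK m s)

/-- Loop erasure: if the new head already occurs, keep only the suffix starting there. -/
theorem exists_nodup_isChain_of_reflTransGen {α : Type*} {r : α → α → Prop} {a b : α}
    (h : Relation.ReflTransGen r a b) :
    ∃ l : List α, (a :: l).IsChain r ∧ (a :: l).Nodup ∧ (a :: l).getLast (by simp) = b := by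
  induction h using Relation.ReflTransGen.head_induction_on with
  | refl => exact ⟨[], by simp⟩
  | @head a c hac _ ih =>
    obtain ⟨l, hl, hnd, hlast⟩ := ih
    by_cases ha : a ∈ c :: l
    · obtain ⟨l₁, l₂, h⟩ := List.append_of_mem ha
      have hsuf : (a :: l₂) <:+ (c :: l) := ⟨l₁, h.symm⟩
      refine ⟨l₂, hl.suffix hsuf, hnd.sublist hsuf.sublist, ?_⟩
      rw [← hlast]
      simp [h]
    · exact ⟨c :: l, List.isChain_cons_cons.2 ⟨hac, hl⟩, List.nodup_cons.2 ⟨ha, hnd⟩, by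
        simpa using hlast⟩

theorem sub_getLast_le {α : Type*} {r : α → α → Prop} {g : α → ℤ} {N : ℤ}
    (hr : ∀ x y, r x y → g x - g y ≤ N) {a : α} {l : List α} (h : (a :: l).IsChain r) :
    g a - g ((a :: l).getLast (by simp)) ≤ N * l.length := by
  induction l generalizing a with
  | nil => simp
  | cons t l ih =>
    rw [List.isChain_cons_cons] at h
    have := ih h.2
    have := hr _ _ h.1
    simp only [List.getLast_cons_cons, List.length_cons]
    push_cast
    linarith

/-- A chain of closed cells whose first and last values of `g` are far apart contains a
self-avoiding chain of any prescribed smaller number of steps. -/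
theorem mem_closedChainEvent_of_reflTransGen {d : ℕ} {nb : Cell d → Finset (Cell d)}
    {b : Config d} {s t : Cell d} {g : Cell d → ℤ} {N : ℤ} {m : ℕ} (hN : 0 < N)
    (hg : ∀ x, ∀ y ∈ nb x, g x - g y ≤ N) (hs : b s = 1)
    (h : Relation.ReflTransGen (fun x y => y ∈ nb x ∧ b y = 1) s t)
    (hm : N * (m - 1) < g s - g t) : b ∈ closedChainEvent nb m s := by
  obtain ⟨l, hl, hnd, hlast⟩ := exists_nodup_isChain_of_reflTransGen h
  have hlen := sub_getLast_le (g := g) (N := N) (fun x y hxy => hg x y hxy.1) hl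
  rw [hlast] at hlen
  have hml : m ≤ l.length := by
    have : ((m : ℤ) - 1) < l.length := lt_of_mul_lt_mul_left (hm.trans_le hlen) hN.le
    omega
  have hclosed : ∀ x ∈ s :: l, b x = 1 := by
    clear hnd hlast hlen hml hm h
    induction l generalizing s with
    | nil => simpa using hs
    | cons t l ih =>
      rw [List.isChain_cons_cons] at hl
      intro x hx
      rcases List.mem_cons.1 hx with rfl | hx
      · exact hs
      · exact ih hl.1.2 hl.2 x hx
  have hpre : (s :: l.take m) <+: (s :: l) := by simpa using List.take_prefix m l
  refine ⟨l.take m, by simpa using hml, ?_, hnd.sublist hpre.sublist, fun x hx =>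
    hclosed x (hpre.subset hx)⟩
  exact (hl.prefix hpre).imp fun x y hxy => hxy.1

/-! ### From a finite plane cluster to a closed chain -/

/-- The embedding of the plane grid as the span of the first two coordinates. -/
def planeCell (e : ℕ) (p : ℤ × ℤ) : Cell (e + 2) :=
  fun i => if i = 0 then p.1 else if i = 1 then p.2 else 0

/-- The possible next cells of a chain of closed cells near the plane. -/
noncomputable def slabNeighbors (e n : ℕ) (x : Cell (e + 2)) : Finset (Cell (e + 2)) :=
  Fintype.piFinset fun i => if i = 0 ∨ i = 1 then Finset.Icc (x i - (2 * n + 1)) (x i + (2 * n + 1))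
    else Finset.Icc (-(n : ℤ)) n

/-- The `m`-th box of side `2 * n + 1` along the first coordinate axis. -/
noncomputable def axisBox (e n m : ℕ) : Finset (Cell (e + 2)) :=
  Fintype.piFinset fun i => if i = 0 then
      Finset.Icc (-(n : ℤ) + m * (2 * n + 1)) (-(n : ℤ) + m * (2 * n + 1) + 2 * n)
    else Finset.Icc (-(n : ℤ)) n

theorem card_slabNeighbors_le (e n : ℕ) (x : Cell (e + 2)) :
    (slabNeighbors e n x).card ≤ 9 * (2 * n + 1) ^ (e + 2) := by
  have h0 : ∀ a : ℤ, (Finset.Icc (a - (2 * n + 1)) (a + (2 * n + 1))).card = 4 * n + 3 := by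
    intro a; rw [Int.card_Icc]; omega
  have h1 : (Finset.Icc (-(n : ℤ)) n).card = 2 * n + 1 := by rw [Int.card_Icc]; omega
  rw [slabNeighbors, Fintype.card_piFinset, Fin.prod_univ_succ, Fin.prod_univ_succ]
  have h2 : ∀ i : Fin e, ¬ (i.succ.succ = 0 ∨ i.succ.succ = 1) := fun i => by
    simp [Fin.ext_iff]
  simp only [h2, if_false, h1, Finset.prod_const, Finset.card_univ, Fintype.card_fin]
  simp only [Fin.succ_zero_eq_one, true_or, or_true, if_true, h0]
  -- The `9` comes from `4 * n + 3 ≤ 3 * (2 * n + 1)` in each plane direction.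
  calc (4 * n + 3) * ((4 * n + 3) * (2 * n + 1) ^ e)
      ≤ (3 * (2 * n + 1)) * ((3 * (2 * n + 1)) * (2 * n + 1) ^ e) := by gcongr <;> omega
    _ = 9 * (2 * n + 1) ^ (e + 2) := by ring

theorem card_axisBox (e n m : ℕ) : (axisBox e n m).card = (2 * n + 1) ^ (e + 2) := by
  rw [axisBox, Fintype.card_piFinset]
  have : ∀ i : Fin (e + 2), (if i = 0 then
      Finset.Icc (-(n : ℤ) + m * (2 * n + 1)) (-(n : ℤ) + m * (2 * n + 1) + 2 * n)
    else Finset.Icc (-(n : ℤ)) n).card = 2 * n + 1 := by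
    intro i
    split_ifs <;> rw [Int.card_Icc] <;> omega
  simp [this]

theorem gridGraph_adj_planeCell {e : ℕ} {p q : ℤ × ℤ} (h : PlaneAdj p q) :
    (gridGraph (e + 2)).Adj (planeCell e p) (planeCell e q) := by
  change ∑ i, |planeCell e p i - planeCell e q i| = 1
  rw [Fin.sum_univ_succ, Fin.sum_univ_succ]
  have h2 : ∀ i : Fin e, i.succ.succ ≠ 1 := fun i => by simp [Fin.ext_iff]
  simpa [planeCell, h2, PlaneAdj] using h

theorem planeCell_injective (e : ℕ) : Function.Injective (planeCell e) := fun p q h =>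
  Prod.ext (by simpa [planeCell] using congrFun h 0) (by simpa [planeCell] using congrFun h 1)

theorem exists_closed_of_thicken_ne_zero {d n : ℕ} {b : Config d} {c : Cell d}
    (h : thicken n b c ≠ 0) : ∃ s, b s = 1 ∧ ∀ i, |s i - c i| ≤ n := by
  by_contra! hcon
  refine h ((Finset.sup_eq_bot_iff _ _).2 fun k hk => ?_)
  have hk' : ∀ i, -(n : ℤ) ≤ k i ∧ k i ≤ n := by simpa [box, Pi.le_def] using hk
  have : b (c + k) ≠ 1 := fun h1 => by
    obtain ⟨i, hi⟩ := hcon _ h1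
    have := abs_le.2 (hk' i)
    simp only [Pi.add_apply, add_sub_cancel_left] at hi
    omega
  change b (c + k) = 0
  omega

/-- The open cells of the plane that are connected to the origin in the plane. -/
def planeCluster {e : ℕ} (w : Config (e + 2)) : Set (ℤ × ℤ) :=
  {p | Relation.ReflTransGen (fun p q => w (planeCell e p) = 0 ∧ w (planeCell e q) = 0 ∧
    PlaneAdj p q) (0, 0) p}

theorem open_of_mem_planeCluster {e : ℕ} {w : Config (e + 2)} (h0 : w 0 = 0) {p : ℤ × ℤ}
    (hp : p ∈ planeCluster w) : w (planeCell e p) = 0 := by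
  rcases Relation.ReflTransGen.cases_tail hp with h | ⟨_, _, h⟩
  · rw [h, show planeCell e (0, 0) = 0 by ext i; simp [planeCell], h0]
  · exact h.2.1

/-- The plane cluster embeds in the full component of the origin, which is finite. -/
theorem planeCluster_finite {e : ℕ} {w : Config (e + 2)} (h0 : w 0 = 0)
    (h : 0 ∉ infiniteComponent w) : (planeCluster w).Finite := by
  set K := (openGraph w).connectedComponentMk ⟨0, h0⟩ with hK
  have hfin : (Subtype.val '' K.supp).Finite := by
    by_contra hinf
    exact h ⟨_, ⟨hinf, K, rfl⟩, ⟨0, h0⟩, rfl, rfl⟩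
  refine Set.Finite.of_finite_image (f := planeCell e) (hfin.subset ?_)
    (planeCell_injective e).injOn
  rintro _ ⟨p, hp, rfl⟩
  refine ⟨⟨planeCell e p, open_of_mem_planeCluster h0 hp⟩, ?_, rfl⟩
  rw [SimpleGraph.ConnectedComponent.mem_supp_iff, hK, SimpleGraph.ConnectedComponent.eq]
  induction hp with
  | refl =>
    have : planeCell e (0, 0) = 0 := by ext i; simp [planeCell]
    simp only [this]
    exact SimpleGraph.Reachable.refl _
  | tail hp hpq ih =>
    refine SimpleGraph.Reachable.trans (SimpleGraph.Adj.reachable ?_) ih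
    exact (gridGraph_adj_planeCell hpq.2.2).symm

theorem thicken_ne_zero_of_mem_outerBoundary {e : ℕ} {w : Config (e + 2)} (h0 : w 0 = 0)
    {q : ℤ × ℤ} (hq : q ∈ outerBoundary (planeCluster w)) : w (planeCell e q) ≠ 0 := by
  obtain ⟨hq, p, hp, hpq⟩ := hq
  exact fun h => hq (Relation.ReflTransGen.tail hp ⟨open_of_mem_planeCluster h0 hp, h, hpq⟩)

theorem exists_closedChain_of_notMem_infiniteComponent {e n : ℕ} {b : Config (e + 2)}
    (h : 0 ∉ infiniteComponent (thicken n b)) :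
    ∃ m, ∃ s ∈ axisBox e n m, b ∈ closedChainEvent (slabNeighbors e n) m s := by
  by_cases h0 : thicken n b 0 = 0
  · have hstep : ∀ z, ∃ s, z ∈ outerBoundary (planeCluster (thicken n b)) →
        b s = 1 ∧ ∀ i, |s i - planeCell e z i| ≤ n := fun z => by
      by_cases hz : z ∈ outerBoundary (planeCluster (thicken n b))
      · obtain ⟨s, hs⟩ := exists_closed_of_thicken_ne_zero
          (thicken_ne_zero_of_mem_outerBoundary h0 hz)
        exact ⟨s, fun _ => hs⟩
      · exact ⟨0, fun h => absurd h hz⟩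
    choose σ hσ using hstep
    have hσ0 : ∀ z ∈ outerBoundary (planeCluster (thicken n b)), |σ z 0 - z.1| ≤ n :=
      fun z hz => by simpa [planeCell] using (hσ z hz).2 0
    have hσ1 : ∀ z ∈ outerBoundary (planeCluster (thicken n b)), |σ z 1 - z.2| ≤ n :=
      fun z hz => by simpa [planeCell] using (hσ z hz).2 1
    have hσ2 : ∀ z ∈ outerBoundary (planeCluster (thicken n b)), ∀ i, i ≠ 0 → i ≠ 1 →
        |σ z i| ≤ n :=
      fun z hz i hi0 hi1 => by simpa [planeCell, hi0, hi1] using (hσ z hz).2 i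
    obtain ⟨k, l, hk, hl, hkB, hlB, hpath⟩ := exists_boundary_path (planeCluster_finite h0 h)
      Relation.ReflTransGen.refl (fun p hp => by
        induction hp with
        | refl => exact Relation.ReflTransGen.refl
        | tail hp hpq ih => exact ih.tail ⟨hp, hp.tail hpq, hpq.2.2⟩)
    have hchain : Relation.ReflTransGen (fun x y => y ∈ slabNeighbors e n x ∧ b y = 1)
        (σ (k, 0)) (σ (-l, 0)) := by
      refine hpath.lift σ fun y z hyz => ⟨?_, (hσ z hyz.2.1).1⟩
      obtain ⟨hy, hz, h1, h2⟩ := hyz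
      refine Fintype.mem_piFinset.2 fun i => ?_
      rw [abs_le] at h1 h2
      by_cases hi0 : i = 0
      · subst hi0
        have := abs_le.1 (hσ0 y hy)
        have := abs_le.1 (hσ0 z hz)
        simp only [true_or, if_true, Finset.mem_Icc]
        omega
      by_cases hi1 : i = 1
      · subst hi1
        have := abs_le.1 (hσ1 y hy)
        have := abs_le.1 (hσ1 z hz)
        simp only [or_true, if_true, Finset.mem_Icc]
        omega
      · have := abs_le.1 (hσ2 z hz i hi0 hi1)
        simpa only [hi0, hi1, or_self, if_false, Finset.mem_Icc] using this
    have hk0 := abs_le.1 (hσ0 _ hkB)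
    have hl0 := abs_le.1 (hσ0 _ hlB)
    simp only at hk0 hl0
    have hN : (0 : ℤ) < 2 * n + 1 := by omega
    -- `m` indexes the axis box containing `σ (k, 0)`; it is nonnegative because `k ≥ 1`.
    obtain ⟨m, hm⟩ := Int.eq_ofNat_of_zero_le
      (Int.ediv_nonneg (a := σ (k, 0) 0 + n) (b := 2 * n + 1) (by omega) hN.le)
    have hdiv := Int.emod_add_mul_ediv (σ (k, 0) 0 + n) (2 * n + 1)
    have hmod0 := Int.emod_nonneg (σ (k, 0) 0 + n) hN.ne'
    have hmod1 := Int.emod_lt_of_pos (σ (k, 0) 0 + n) hN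
    rw [hm] at hdiv
    refine ⟨m, σ (k, 0), Fintype.mem_piFinset.2 fun i => ?_,
      mem_closedChainEvent_of_reflTransGen (g := fun x => x 0) hN ?_ (hσ _ hkB).1 hchain ?_⟩
    · by_cases hi0 : i = 0
      · subst hi0
        simp only [if_true, Finset.mem_Icc]
        constructor <;> linarith
      by_cases hi1 : i = 1
      · subst hi1
        simpa [abs_le] using hσ1 _ hkB
      · simpa [hi0, abs_le] using hσ2 _ hkB i hi0 hi1
    · intro x y hy
      have := Fintype.mem_piFinset.1 hy 0
      simp only [true_or, if_true, Finset.mem_Icc] at this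
      linarith [this.1]
    -- The start has first coordinate at least `m * (2 * n + 1) - n`, the end at most `n - 1`.
    · linarith
  · obtain ⟨s, hs, hsn⟩ := exists_closed_of_thicken_ne_zero h0
    -- If the origin is closed after thickening, one closed cell in the box `m = 0` suffices.
    refine ⟨0, s, Fintype.mem_piFinset.2 fun i => ?_, [], rfl, by simp, by simp, by simpa using hs⟩
    have := abs_le.1 (hsn i)
    simp only [Pi.zero_apply, sub_zero] at this
    split_ifs <;> simp only [Finset.mem_Icc] <;> push_cast <;> omega

/-! ### Summing the geometric series -/

theorem measure_notMem_infiniteComponent_le (e n : ℕ) (ε : unitInterval) :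
    bernoulliPercolation (e + 2) ε {b | 0 ∉ infiniteComponent (thicken n b)} ≤
      ((2 * n + 1) ^ (e + 2) : ℕ) * ENNReal.ofReal ε *
        (1 - (9 * (2 * n + 1) ^ (e + 2) : ℕ) * ENNReal.ofReal ε)⁻¹ := by
  have hsub : {b : Config (e + 2) | 0 ∉ infiniteComponent (thicken n b)} ⊆
      ⋃ m, ⋃ s ∈ axisBox e n m, closedChainEvent (slabNeighbors e n) m s := fun b hb => by
    simpa only [Set.mem_iUnion, exists_prop] using
      exists_closedChain_of_notMem_infiniteComponent hb
  refine (measure_mono hsub).trans ((measure_iUnion_le _).trans ?_)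
  rw [← ENNReal.tsum_geometric, ← ENNReal.tsum_mul_left]
  refine ENNReal.tsum_le_tsum fun m => (measure_biUnion_finset_le _ _).trans ?_
  refine (Finset.sum_le_card_nsmul _ _ _ fun s _ =>
    measure_closedChainEvent_le (card_slabNeighbors_le e n) ε m s).trans (le_of_eq ?_)
  rw [card_axisBox, nsmul_eq_mul]
  ring

end ThickPercolation

theorem mainTheorem10 (d : ℕ) (hd : 2 ≤ d) (n : ℕ) (ε : unitInterval) :
    (ThickPercolation.bernoulliPercolation d ε).real
        {b | (0 : ThickPercolation.Cell d) ∉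
          ThickPercolation.infiniteComponent (ThickPercolation.thicken n b)}
      ≤ 48 * (2 * (n : ℝ) + 1) ^ d * (ε : ℝ) := by
  obtain ⟨e, rfl⟩ := Nat.exists_eq_add_of_le' hd
  have hε : (0 : ℝ) ≤ ε := ε.2.1
  set V : ℝ := (2 * (n : ℝ) + 1) ^ (e + 2) with hV
  have hV0 : 0 ≤ V := by positivity
  have : IsProbabilityMeasure (ThickPercolation.bernoulliPercolation (e + 2) ε) := by
    unfold ThickPercolation.bernoulliPercolation; infer_instance
  -- Either the bound is trivial, or `9 * V * ε < 9 / 48` and the geometric factor is below `48 /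
  -- 39`.
  rcases le_or_gt 1 (48 * V * ε) with hbig | hsmall
  · exact measureReal_le_one.trans hbig
  · refine ENNReal.toReal_le_of_le_ofReal (by positivity)
      ((ThickPercolation.measure_notMem_infiniteComponent_le e n ε).trans ?_)
    have h1 : (((2 * n + 1) ^ (e + 2) : ℕ) : ENNReal) = ENNReal.ofReal V := by
      rw [← ENNReal.ofReal_natCast]; simp [hV]
    have h2 : ((9 * (2 * n + 1) ^ (e + 2) : ℕ) : ENNReal) = ENNReal.ofReal (9 * V) := by
      rw [← ENNReal.ofReal_natCast]; simp [hV]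
    have hpos : 0 < 1 - 9 * V * ε := by nlinarith
    rw [h1, h2, ← ENNReal.ofReal_mul hV0, ← ENNReal.ofReal_mul (by positivity),
      ← ENNReal.ofReal_one, ← ENNReal.ofReal_sub _ (by positivity),
      ← ENNReal.ofReal_inv_of_pos hpos, ← ENNReal.ofReal_mul (by positivity)]
    refine ENNReal.ofReal_le_ofReal ?_
    have hinv : (1 - 9 * V * ε)⁻¹ ≤ 48 := by
      rw [inv_le_comm₀ hpos (by norm_num)]
      linarith
    calc V * ε * (1 - 9 * V * ε)⁻¹ ≤ V * ε * 48 := by gcongr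
      _ = 48 * V * ε := by ring
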